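/- Let $X$ be a countably infinite set, let $m:X\to(0,\infty)$, and let $b:X\times X\to[0,\infty)$ satisfy $b(x,x)=0$, $b(x,y)=b(y,x)$ and $\sum_{y\in X}b(x,y)<\infty$ for all $x,y\in X$; write $x\sim y$ if $b(x,y)>0$. Assume that the weighted graph $G=(X,b,m)$ is locally finite (every vertex has only finitely many neighbors), connected (any two vertices are joined by a finite path of neighboring vertices), and that $\inf_{x\in X}m(x)>0$. Let $\varrho:X\times X\to[0,\infty)$ be a pseudo metric which is intrinsic, that is, $$\sum_{y\in X}b(x,y)\varrho^2(x,y)\le m(x)\quad\text{for all }x\in X,$$ and whose distance balls $\{y\in X : \varrho(x,y)\le r\}$, $x\in X$, $r\in\mathbb R$, are all finite. For $f,g:X\to\mathbb R$ let $$\mathcal L f(x)=\frac1{m(x)}\sum_{y\in X}b(x,y)(f(x)-f(y)),\qquad \Gamma(f,g)=-\tfrac12\bigl(\mathcal L(fg)-f\mathcal L g-g\mathcal L f\bigr),$$ $\Gamma(f)=\Gamma(f,f)$ and $\Gamma_2(f)=-\frac12\mathcal L\Gamma(f)+\Gamma(f,\mathcal L f)$. Let $K\in\mathbb R$ and assume that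 $G$ satisfies the Bakry--Émery curvature condition $CD(K,\infty)$: $\Gamma_2(f)(x)\ge K\,\Gamma(f)(x)$ for all $f:X\to\mathbb R$ and all $x\in X$. Then $G$ is stochastically complete, that is, $$\sum_{y\in X}p_t(x,y)m(y)=1\quad\text{for all }x\in X\text{ and all }t\ge0.$$ Here $p_t(x,y)$ is the heat kernel of $G$, the limit $p_t(x,y)=\lim_A p_t^A(x,y)$ of the restricted heat kernels as the finite sets $A\subseteq X$ increase to $X$, where $p_t^A(x,y)=\bigl(e^{-tL_A}\tfrac{1_y}{m(y)}\bigr)(x)$ for $x,y\in A$ and $L_A$ is the restriction of $\mathcal L$ to the functions on $A$ (extended by $0$ to $X$). -/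

import Mathlib

/-- A weighted graph `(X, b, m)` on a vertex set `X`: a strictly positive vertex measure `m` and a
nonnegative symmetric edge weight `b` without loops and with summable rows. (That `X` is countably
infinite is imposed in the theorem by instances.) -/
structure WeightedGraph (X : Type*) where
  /-- the vertex measure -/
  m : X → ℝ
  /-- the edge weight -/
  b : X → X → ℝ
  m_pos : ∀ x, 0 < m x
  b_nonneg : ∀ x y, 0 ≤ b x y
  b_self : ∀ x, b x x = 0
  b_symm : ∀ x y, b x y = b y x
  b_summable : ∀ x, Summable (fun y => b x y)

namespace WeightedGraph

variable {X : Type*} (G : WeightedGraph X)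

/-- `x ∼ y`: the vertices `x` and `y` are neighbors. -/
def Adj (x y : X) : Prop := 0 < G.b x y

/-- Every vertex has only finitely many neighbors. -/
def LocallyFinite : Prop := ∀ x, {y | G.Adj x y}.Finite

/-- Any two vertices are joined by a finite path (possibly without edges). -/
def Connected : Prop := ∀ x y, Relation.ReflTransGen G.Adj x y

/-- The formal Laplacian `𝓛 f (x) = (1 / m x) ∑_y b(x,y) (f x - f y)`. The sum has only finitely
many nonzero terms if the graph is locally finite, and it is absolutely convergent for every
bounded function `f` on an arbitrary graph. -/
noncomputable def laplacian (f : X → ℝ) (x : X) : ℝ :=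
  (1 / G.m x) * ∑' y, G.b x y * (f x - f y)

/-- `Γ(f,g) = -½ (𝓛(fg) - f 𝓛g - g 𝓛f)`. -/
noncomputable def Gam (f g : X → ℝ) (x : X) : ℝ :=
  -(1 / 2) * (G.laplacian (f * g) x - f x * G.laplacian g x - g x * G.laplacian f x)

/-- `Γ₂(f) = -½ 𝓛 Γ(f) + Γ(f, 𝓛f)`, where `Γ(f) = Γ(f,f)`. -/
noncomputable def Gam₂ (f : X → ℝ) (x : X) : ℝ :=
  -(1 / 2) * G.laplacian (G.Gam f f) x + G.Gam f (G.laplacian f) x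

/-- The Bakry--Émery curvature condition `CD(K,∞)`. -/
def CD (K : ℝ) : Prop := ∀ (f : X → ℝ) (x : X), K * G.Gam f f x ≤ G.Gam₂ f x

/-- The (pseudo) metric of `X` is intrinsic: `∑_y b(x,y) ϱ(x,y)² ≤ m(x)` for all `x`. -/
def IsIntrinsic [PseudoMetricSpace X] : Prop :=
  ∀ x, Summable (fun y => G.b x y * dist x y ^ 2) ∧ ∑' y, G.b x y * dist x y ^ 2 ≤ G.m x

open Classical in
/-- The matrix, in the basis of the functions `1_y`, `y ∈ A`, of the restriction `L_A` of the
formal Laplacian to the functions on a finite set `A` (extended by zero to `X`): its entry at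
`(x, y)` is `𝓛 1_y (x)`. -/
noncomputable def restrictedLaplacian (A : Finset X) : Matrix A A ℝ :=
  Matrix.of fun x y => G.laplacian (Pi.single (y : X) 1) x

open Classical in
/-- The restricted heat kernel `p_t^A(x,y) = e^{-t L_A} (1_y / m y) (x)` for `x, y ∈ A`, extended by
zero. -/
noncomputable def restrictedHeatKernel (A : Finset X) (t : ℝ) (x y : X) : ℝ :=
  if h : x ∈ A ∧ y ∈ A then
    Matrix.mulVec (NormedSpace.exp (-t • G.restrictedLaplacian A))
      (Pi.single ⟨y, h.2⟩ (1 / G.m y)) ⟨x, h.1⟩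
  else 0

/-- `p` is the heat kernel of the graph: the limit of the restricted heat kernels as the finite
sets exhaust `X`. -/
def IsHeatKernel (p : ℝ → X → X → ℝ) : Prop :=
  ∀ t, 0 ≤ t → ∀ x y, Filter.Tendsto (fun A : Finset X => G.restrictedHeatKernel A t x y)
    Filter.atTop (nhds (p t x y))

/-- Stochastic completeness: the heat kernel satisfies `∑_y p_t(x,y) m(y) = 1` for all `x` and all
`t ≥ 0`. (The heat kernel is unique on `[0,∞)`, being a limit.) -/
def StochasticallyComplete : Prop :=
  ∃ p : ℝ → X → X → ℝ, G.IsHeatKernel p ∧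
    ∀ t, 0 ≤ t → ∀ x, HasSum (fun y => p t x y * G.m y) 1

end WeightedGraph

/-! Stochastic completeness is reduced to `lam (lam + L)⁻¹ 1 = 1` for the minimal resolvent at a
single `lam > 0` with `K + lam > 0`. To prove this identity, solve `lam u + 𝓛 u = η` for the cutoff
`η = (1 - ϱ(o, ·)/R)₊`, which is finitely supported because balls are finite. Green's formula gives
`u` finite energy (`sum_gam_resolvent_le`, `exists_limit_resolvent`). Since `m` is bounded below, a
positive value of `Γ(u)` is exceeded only finitely often, so `Γ(u)` attains its maximum unless it
vanishes. There `𝓛 Γ(u) ≥ 0`, and the curvature condition with Cauchy–Schwarz gives `(K + lam)² Γ(u)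
≤ sup Γ(η) ≤ 1/R²` (`gam_le_of_resolvent_equation`). Hence `𝓛 u(o) = O(1/R)` and `lam u(o) ≥ 1 -
O(1/R)`; let `R → ∞`. A parabolic comparison on finite sets then bounds the heat kernel mass below
by `1 - exp(lam t) (1 - lam u_A)`, where `u_A` is the Dirichlet resolvent of `1`
(`le_sum_restrictedHeatKernel`). -/

open Filter Topology

/-! ### Positivity and comparison for matrix semigroups. -/

section MatrixSemigroup

open NormedSpace

attribute [local instance] Matrix.linftyOpNormedRing Matrix.linftyOpNormedAlgebra

variable {ι : Type*} [Fintype ι] [DecidableEq ι]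

theorem Matrix.exp_apply_nonneg_of_nonneg (N : Matrix ι ι ℝ) (hN : ∀ i j, 0 ≤ N i j) (i j : ι) :
    0 ≤ exp N i j := by
  have hpow : ∀ (n : ℕ) i j, 0 ≤ (N ^ n) i j := by
    intro n
    induction n with
    | zero => intro i j; by_cases h : i = j <;> simp [h]
    | succ n ih =>
      intro i j
      rw [pow_succ, Matrix.mul_apply]
      exact Finset.sum_nonneg fun k _ => mul_nonneg (ih i k) (hN k j)
  have hs : HasSum (fun n : ℕ => ((n.factorial : ℝ)⁻¹) • N ^ n) (exp N) :=
    exp_series_hasSum_exp' (𝕂 := ℝ) N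
  have hij := hs.map (Matrix.entryLinearMap ℝ ℝ i j : Matrix ι ι ℝ →ₗ[ℝ] ℝ)
    (LinearMap.continuous_of_finiteDimensional _)
  refine hij.nonneg fun n => ?_
  simp only [Function.comp, Matrix.entryLinearMap_apply, Matrix.smul_apply, smul_eq_mul]
  exact mul_nonneg (by positivity) (hpow n i j)

/-- A scalar shift makes `-M` entrywise nonnegative, and the scalar part only contributes a positive
factor to the exponential. -/
theorem Matrix.exp_neg_smul_apply_nonneg (M : Matrix ι ι ℝ) (hM : ∀ i j, i ≠ j → M i j ≤ 0)
    {t : ℝ} (ht : 0 ≤ t) (i j : ι) : 0 ≤ exp (-t • M) i j := by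
  set c : ℝ := ∑ k, |M k k|
  have hN : ∀ i j, 0 ≤ (t • (c • (1 : Matrix ι ι ℝ) - M)) i j := by
    intro i j
    simp only [Matrix.smul_apply, Matrix.sub_apply, smul_eq_mul]
    refine mul_nonneg ht ?_
    by_cases h : i = j
    · subst h
      have : |M i i| ≤ c :=
        Finset.single_le_sum (f := fun k => |M k k|) (fun _ _ => abs_nonneg _) (Finset.mem_univ i)
      simp
      linarith [le_abs_self (M i i)]
    · simpa [Matrix.one_apply, h] using hM i j h
  have hsplit : -t • M = algebraMap ℝ (Matrix ι ι ℝ) (-(t * c))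
      + t • (c • (1 : Matrix ι ι ℝ) - M) := by
    rw [Algebra.algebraMap_eq_smul_one]
    module
  have hexp : exp (algebraMap ℝ (Matrix ι ι ℝ) (-(t * c)))
      = algebraMap ℝ (Matrix ι ι ℝ) (exp (-(t * c))) := (algebraMap_exp_comm (-(t * c))).symm
  rw [hsplit, Matrix.exp_add_of_commute _ _ (Algebra.commute_algebraMap_left _ _),
    hexp, Algebra.algebraMap_eq_smul_one, smul_mul_assoc, one_mul,
    Matrix.smul_apply, smul_eq_mul, ← Real.exp_eq_exp_ℝ]
  exact mul_nonneg (Real.exp_pos _).le (Matrix.exp_apply_nonneg_of_nonneg _ hN i j)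

theorem Matrix.hasDerivAt_exp_neg_smul_apply (M : Matrix ι ι ℝ) (t : ℝ) (i j : ι) :
    HasDerivAt (fun s : ℝ => exp (-s • M) i j) (-(exp (-t • M) * M) i j) t := by
  have h := (hasDerivAt_exp_smul_const (𝕂 := ℝ) M (-t)).scomp t (hasDerivAt_neg t)
  have h2 := (Matrix.entryLinearMap ℝ ℝ i j :
    Matrix ι ι ℝ →ₗ[ℝ] ℝ).toContinuousLinearMap.hasFDerivAt.comp_hasDerivAt t h
  have h3 : (Matrix.entryLinearMap ℝ ℝ i j : Matrix ι ι ℝ →ₗ[ℝ] ℝ).toContinuousLinearMap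
      ((-1 : ℝ) • (exp (-t • M) * M)) = -(exp (-t • M) * M) i j := by
    simp [Matrix.entryLinearMap_apply]
  rw [← h3]
  exact h2

theorem Matrix.exp_neg_smul_mul_comm (M : Matrix ι ι ℝ) (t : ℝ) :
    exp (-t • M) * M = M * exp (-t • M) :=
  (((Commute.refl M).smul_left (-t)).exp_left).eq

/-- With `M` on the left, each column of the semigroup solves `φ' + M φ = 0`, the form required by
the comparison principle. -/
theorem Matrix.hasDerivAt_exp_neg_smul_apply_eq_sum (M : Matrix ι ι ℝ) (t : ℝ) (i j : ι) :
    HasDerivAt (fun s : ℝ => exp (-s • M) i j) (-∑ k, M i k * exp (-t • M) k j) t := by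
  rw [← Matrix.mul_apply, ← Matrix.exp_neg_smul_mul_comm]
  exact Matrix.hasDerivAt_exp_neg_smul_apply M t i j

/-- Comparison principle: supersolutions of the linear evolution equation `φ' + M φ = 0` with
nonnegative initial value are nonnegative, provided the off-diagonal entries of `M` are
nonpositive. -/
theorem Matrix.nonneg_of_supersolution (M : Matrix ι ι ℝ) (hM : ∀ i j, i ≠ j → M i j ≤ 0)
    (φ ψ : ℝ → ι → ℝ) (hφ : ∀ s i, HasDerivAt (fun r => φ r i) (ψ s i) s)
    (h0 : ∀ i, 0 ≤ φ 0 i) (hsup : ∀ s, 0 ≤ s → ∀ i, 0 ≤ ψ s i + ∑ j, M i j * φ s j)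
    {t : ℝ} (ht : 0 ≤ t) (i : ι) : 0 ≤ φ t i := by
  have hE : ∀ s j, HasDerivAt (fun r : ℝ => exp (-(t - r) • M) i j)
      ((exp (-(t - s) • M) * M) i j) s := by
    intro s j
    have := (Matrix.hasDerivAt_exp_neg_smul_apply M (t - s) i j).comp_const_sub t s
    simpa using this
  -- Duhamel: `s ↦ exp(-(t - s) M) φ(s)` has derivative `exp(-(t - s) M) (φ' + M φ)(s)`, which is
  -- nonnegative on `[0, t]`. It runs from `exp(-t M) φ(0) ≥ 0` to `φ(t)`.
  have hd : ∀ s, HasDerivAt (fun r => ∑ j, exp (-(t - r) • M) i j * φ r j)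
      (∑ j, exp (-(t - s) • M) i j * (ψ s j + ∑ k, M j k * φ s k)) s := by
    intro s
    refine (HasDerivAt.fun_sum (u := Finset.univ) fun j _ =>
      (hE s j).fun_mul (hφ s j)).congr_deriv ?_
    symm
    simp only [mul_add, Finset.sum_add_distrib, Matrix.mul_apply, Finset.sum_mul, Finset.mul_sum]
    rw [add_comm]
    congr 1
    rw [Finset.sum_comm]
    simp only [mul_assoc]
  have hmono : MonotoneOn (fun r => ∑ j, exp (-(t - r) • M) i j * φ r j) (Set.Icc 0 t) := by
    refine monotoneOn_of_deriv_nonneg (convex_Icc 0 t)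
      (fun s _ => (hd s).continuousAt.continuousWithinAt)
      (fun s _ => (hd s).differentiableAt.differentiableWithinAt) fun s hs => ?_
    rw [interior_Icc] at hs
    rw [(hd s).deriv]
    exact Finset.sum_nonneg fun j _ => mul_nonneg
      (Matrix.exp_neg_smul_apply_nonneg M hM (by linarith [hs.2]) i j) (hsup s hs.1.le j)
  have h1 := hmono (Set.left_mem_Icc.2 ht) (Set.right_mem_Icc.2 ht) ht
  have h2 : 0 ≤ ∑ j, exp (-(t - 0) • M) i j * φ 0 j := Finset.sum_nonneg fun j _ =>
    mul_nonneg (Matrix.exp_neg_smul_apply_nonneg M hM (by linarith) i j) (h0 j)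
  have h3 : ∑ j, exp (-(t - t) • M) i j * φ t j = φ t i := by
    simp [Matrix.one_apply]
  linarith [h2.trans h1]

end MatrixSemigroup

/-! ### Finite-sum formulas and Cauchy–Schwarz for `𝓛` and `Γ`. -/

namespace WeightedGraph

variable {X : Type*} {G : WeightedGraph X}

theorem b_eq_zero_of_not_mem (hlf : G.LocallyFinite) {x y : X} (h : y ∉ (hlf x).toFinset) :
    G.b x y = 0 := by
  simp only [Set.Finite.mem_toFinset, Set.mem_ofPred_eq, Adj, not_lt] at h
  exact le_antisymm h (G.b_nonneg x y)

/-- Allowing any `B` that contains the neighbors lets several vertices share one summation set, as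
Green's formula needs. -/
theorem tsum_b_mul_of_subset (hlf : G.LocallyFinite) {x : X} {B : Finset X}
    (hB : (hlf x).toFinset ⊆ B) (g : X → ℝ) :
    ∑' y, G.b x y * g y = ∑ y ∈ B, G.b x y * g y :=
  tsum_eq_sum fun y hy => by rw [b_eq_zero_of_not_mem hlf fun h => hy (hB h), zero_mul]

theorem laplacian_eq_sum (hlf : G.LocallyFinite) {x : X} {B : Finset X}
    (hB : (hlf x).toFinset ⊆ B) (f : X → ℝ) :
    G.laplacian f x = (1 / G.m x) * ∑ y ∈ B, G.b x y * (f x - f y) := by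
  rw [laplacian, tsum_b_mul_of_subset hlf hB fun y => f x - f y]

theorem gam_eq_sum (hlf : G.LocallyFinite) {x : X} {B : Finset X}
    (hB : (hlf x).toFinset ⊆ B) (f g : X → ℝ) :
    G.Gam f g x = 1 / (2 * G.m x) * ∑ y ∈ B, G.b x y * ((f x - f y) * (g x - g y)) := by
  have hm := (G.m_pos x).ne'
  rw [Gam, laplacian_eq_sum hlf hB, laplacian_eq_sum hlf hB, laplacian_eq_sum hlf hB]
  have : ∑ y ∈ B, G.b x y * ((f * g) x - (f * g) y)
      = f x * ∑ y ∈ B, G.b x y * (g x - g y) + g x * ∑ y ∈ B, G.b x y * (f x - f y)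
        - ∑ y ∈ B, G.b x y * ((f x - f y) * (g x - g y)) := by
    rw [Finset.mul_sum, Finset.mul_sum, ← Finset.sum_add_distrib, ← Finset.sum_sub_distrib]
    refine Finset.sum_congr rfl fun y _ => ?_
    simp only [Pi.mul_apply]
    ring
  rw [this]
  field_simp
  ring

theorem gam_self_nonneg (hlf : G.LocallyFinite) (f : X → ℝ) (x : X) : 0 ≤ G.Gam f f x := by
  rw [gam_eq_sum hlf subset_rfl]
  have := G.m_pos x
  exact mul_nonneg (by positivity) (Finset.sum_nonneg fun y _ =>
    mul_nonneg (G.b_nonneg x y) (mul_self_nonneg _))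

theorem gam_sq_le (hlf : G.LocallyFinite) (f g : X → ℝ) (x : X) :
    G.Gam f g x ^ 2 ≤ G.Gam f f x * G.Gam g g x := by
  simp only [gam_eq_sum hlf subset_rfl]
  have h := Finset.sum_mul_sq_le_sq_mul_sq (hlf x).toFinset
    (fun y => √(G.b x y) * (f x - f y)) (fun y => √(G.b x y) * (g x - g y))
  have hs : ∀ y, √(G.b x y) ^ 2 = G.b x y := fun y => Real.sq_sqrt (G.b_nonneg x y)
  have e1 : ∀ (p q : X → ℝ), ∑ y ∈ (hlf x).toFinset,
      √(G.b x y) * (p x - p y) * (√(G.b x y) * (q x - q y))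
      = ∑ y ∈ (hlf x).toFinset, G.b x y * ((p x - p y) * (q x - q y)) := fun p q =>
    Finset.sum_congr rfl fun y _ => by rw [← hs y, Real.sqrt_sq (Real.sqrt_nonneg _)]; ring
  simp only [pow_two (_ * _), e1] at h
  rw [mul_pow, mul_mul_mul_comm, ← pow_two (1 / (2 * G.m x))]
  exact mul_le_mul_of_nonneg_left h (sq_nonneg _)

/-- Cauchy–Schwarz for `√b` and `√b (f x - f y)`. This turns a gradient bound into a pointwise bound
on `𝓛 f`. -/
theorem laplacian_sq_le (hlf : G.LocallyFinite) (f : X → ℝ) (x : X) :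
    G.laplacian f x ^ 2 ≤
      (2 / G.m x * ∑ y ∈ (hlf x).toFinset, G.b x y) * G.Gam f f x := by
  rw [laplacian_eq_sum hlf subset_rfl, gam_eq_sum hlf subset_rfl]
  have hm := G.m_pos x
  have h := Finset.sum_mul_sq_le_sq_mul_sq (hlf x).toFinset
    (fun y => √(G.b x y)) (fun y => √(G.b x y) * (f x - f y))
  have hs : ∀ y, √(G.b x y) ^ 2 = G.b x y := fun y => Real.sq_sqrt (G.b_nonneg x y)
  simp only [← mul_assoc, ← pow_two, mul_pow, hs] at h
  rw [mul_pow]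
  calc _ ≤ (1 / G.m x) ^ 2 * ((∑ y ∈ (hlf x).toFinset, G.b x y) *
        ∑ y ∈ (hlf x).toFinset, G.b x y * (f x - f y) ^ 2) :=
        mul_le_mul_of_nonneg_left h (sq_nonneg _)
    _ = _ := by
        simp only [← pow_two (f x - f _)]
        field_simp

theorem laplacian_smul_add (hlf : G.LocallyFinite) (a c : ℝ) (f g : X → ℝ) (x : X) :
    G.laplacian (fun z => a * f z + c * g z) x = a * G.laplacian f x + c * G.laplacian g x := by
  simp only [laplacian_eq_sum hlf subset_rfl]
  have : ∑ y ∈ (hlf x).toFinset, G.b x y * (a * f x + c * g x - (a * f y + c * g y))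
      = a * ∑ y ∈ (hlf x).toFinset, G.b x y * (f x - f y)
        + c * ∑ y ∈ (hlf x).toFinset, G.b x y * (g x - g y) := by
    rw [Finset.mul_sum, Finset.mul_sum, ← Finset.sum_add_distrib]
    exact Finset.sum_congr rfl fun y _ => by ring
  rw [this]
  ring

theorem laplacian_const (G : WeightedGraph X) (c : ℝ) (x : X) :
    G.laplacian (fun _ => c) x = 0 := by
  simp [laplacian]

theorem laplacian_nonneg_of_forall_le (f : X → ℝ) (x : X) (h : ∀ y, f y ≤ f x) :
    0 ≤ G.laplacian f x :=
  mul_nonneg (one_div_pos.2 (G.m_pos x)).le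
    (tsum_nonneg fun y => mul_nonneg (G.b_nonneg x y) (sub_nonneg.2 (h y)))

theorem laplacian_nonpos_of_forall_le (hlf : G.LocallyFinite) (f : X → ℝ) (x : X)
    (h : ∀ y, f x ≤ f y) : G.laplacian f x ≤ 0 := by
  rw [laplacian_eq_sum hlf subset_rfl]
  exact mul_nonpos_of_nonneg_of_nonpos (one_div_pos.2 (G.m_pos x)).le
    (Finset.sum_nonpos fun y _ =>
      mul_nonpos_of_nonneg_of_nonpos (G.b_nonneg x y) (sub_nonpos.2 (h y)))

/-! ### Dirichlet resolvents on finite sets. -/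

/-- Minimum principle for `lam + 𝓛` on a finite set. -/
theorem nonneg_of_resolvent_supersolution (hlf : G.LocallyFinite) {lam : ℝ} (hl : 0 < lam)
    (A : Finset X) (v : X → ℝ) (hA : ∀ x ∈ A, 0 ≤ lam * v x + G.laplacian v x)
    (hout : ∀ x, x ∉ A → 0 ≤ v x) (x : X) : 0 ≤ v x := by
  by_contra! hx
  have hxA : x ∈ A := by by_contra h; exact absurd (hout x h) (not_le.2 hx)
  obtain ⟨z, hz, hmin⟩ := A.exists_min_image v ⟨x, hxA⟩
  have hzneg : v z < 0 := (hmin x hxA).trans_lt hx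
  have hglob : ∀ y, v z ≤ v y := fun y => by
    by_cases hy : y ∈ A
    · exact hmin y hy
    · exact hzneg.le.trans (hout y hy)
  have h1 := laplacian_nonpos_of_forall_le hlf v z hglob
  have h2 := hA z hz
  nlinarith [mul_pos_of_neg_of_neg hzneg (neg_lt_zero.2 hl)]

theorem resolvent_comparison (hlf : G.LocallyFinite) {lam : ℝ} (hl : 0 < lam)
    (A : Finset X) (u v : X → ℝ)
    (hA : ∀ x ∈ A, lam * u x + G.laplacian u x ≤ lam * v x + G.laplacian v x)
    (hout : ∀ x, x ∉ A → u x ≤ v x) (x : X) : u x ≤ v x := by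
  have := nonneg_of_resolvent_supersolution hlf hl A (fun z => 1 * v z + (-1) * u z)
    (fun x hx => by rw [laplacian_smul_add hlf]; linarith [hA x hx])
    (fun x hx => by linarith [hout x hx]) x
  linarith

open Classical in
/-- Extension by zero of a function on a finite set. -/
noncomputable def extendZero (A : Finset X) (f : A → ℝ) (x : X) : ℝ :=
  if h : x ∈ A then f ⟨x, h⟩ else 0

theorem extendZero_coe (A : Finset X) (f : A → ℝ) (x : A) : extendZero A f x = f x := by
  simp [extendZero]

theorem extendZero_of_not_mem (A : Finset X) (f : A → ℝ) {x : X} (h : x ∉ A) :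
    extendZero A f x = 0 := by
  simp [extendZero, h]

/-- The operator `lam + L_A` acts on a finite-dimensional space and is injective by comparison,
hence surjective. -/
theorem exists_resolvent (hlf : G.LocallyFinite) {lam : ℝ} (hl : 0 < lam) (η : X → ℝ)
    (A : Finset X) : ∃ u : X → ℝ, (∀ x, x ∉ A → u x = 0) ∧
      ∀ x ∈ A, lam * u x + G.laplacian u x = η x := by
  have hext : ∀ (a c : ℝ) (f g : A → ℝ), extendZero A (a • f + c • g)
      = fun z => a * extendZero A f z + c * extendZero A g z := by
    intro a c f g
    funext z
    by_cases h : z ∈ A <;> simp [extendZero, h]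
  let T : (A → ℝ) →ₗ[ℝ] (A → ℝ) :=
    { toFun := fun f x => lam * f x + G.laplacian (extendZero A f) x
      map_add' := fun f g => by
        funext x
        have := hext 1 1 f g
        rw [one_smul, one_smul] at this
        simp only [this, Pi.add_apply, laplacian_smul_add hlf]
        ring
      map_smul' := fun a f => by
        funext x
        have := hext a 0 f 0
        rw [zero_smul, add_zero] at this
        simp only [this, Pi.smul_apply, smul_eq_mul, RingHom.id_apply, laplacian_smul_add hlf]
        ring }
  have hT : ∀ f (x : A), T f x = lam * f x + G.laplacian (extendZero A f) x := fun _ _ => rfl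
  have hinj : Function.Injective T := by
    intro f g hfg
    have key : ∀ f g, T f = T g → ∀ x, extendZero A f x ≤ extendZero A g x := by
      intro f g hfg
      refine resolvent_comparison hlf hl A _ _ (fun x hx => ?_) (fun x hx => ?_)
      · have h1 := congrFun hfg ⟨x, hx⟩
        rw [hT, hT] at h1
        have h2 := extendZero_coe A f ⟨x, hx⟩
        have h3 := extendZero_coe A g ⟨x, hx⟩
        simp only at h1 h2 h3
        rw [h2, h3]
        exact h1.le
      · rw [extendZero_of_not_mem A f hx, extendZero_of_not_mem A g hx]
    funext x
    rw [← extendZero_coe A f x, ← extendZero_coe A g x]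
    exact le_antisymm (key f g hfg x) (key g f hfg.symm x)
  obtain ⟨f, hf⟩ := (LinearMap.injective_iff_surjective.1 hinj) (fun x => η x)
  refine ⟨extendZero A f, fun x hx => extendZero_of_not_mem A f hx, fun x hx => ?_⟩
  have := congrFun hf ⟨x, hx⟩
  rw [hT, ← extendZero_coe A f ⟨x, hx⟩] at this
  exact this

/-- The resolvent with Dirichlet boundary condition on the finite set `A`, applied to `η`. -/
noncomputable def resolvent (hlf : G.LocallyFinite) {lam : ℝ} (hl : 0 < lam) (η : X → ℝ)
    (A : Finset X) : X → ℝ := (exists_resolvent hlf hl η A).choose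

section Resolvent

variable (hlf : G.LocallyFinite) {lam : ℝ} (hl : 0 < lam) (η : X → ℝ)

theorem resolvent_of_not_mem (A : Finset X) {x : X} (hx : x ∉ A) :
    resolvent hlf hl η A x = 0 := (exists_resolvent hlf hl η A).choose_spec.1 x hx

theorem resolvent_spec (A : Finset X) {x : X} (hx : x ∈ A) :
    lam * resolvent hlf hl η A x + G.laplacian (resolvent hlf hl η A) x = η x :=
  (exists_resolvent hlf hl η A).choose_spec.2 x hx

theorem resolvent_nonneg (hη : ∀ x, 0 ≤ η x) (A : Finset X) (x : X) :
    0 ≤ resolvent hlf hl η A x :=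
  nonneg_of_resolvent_supersolution hlf hl A _
    (fun x hx => by rw [resolvent_spec hlf hl η A hx]; exact hη x)
    (fun x hx => (resolvent_of_not_mem hlf hl η A hx).ge) x

theorem resolvent_le (hη : ∀ x, η x ≤ 1) (A : Finset X) (x : X) :
    resolvent hlf hl η A x ≤ 1 / lam :=
  resolvent_comparison hlf hl A _ (fun _ => 1 / lam)
    (fun x hx => by
      rw [resolvent_spec hlf hl η A hx, laplacian_const, mul_one_div_cancel hl.ne', add_zero]
      exact hη x)
    (fun x hx => by rw [resolvent_of_not_mem hlf hl η A hx]; positivity) x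

theorem resolvent_mono_right {η₁ η₂ : X → ℝ} (h : ∀ x, η₁ x ≤ η₂ x) (A : Finset X) (x : X) :
    resolvent hlf hl η₁ A x ≤ resolvent hlf hl η₂ A x :=
  resolvent_comparison hlf hl A _ _
    (fun x hx => by
      rw [resolvent_spec hlf hl η₁ A hx, resolvent_spec hlf hl η₂ A hx]; exact h x)
    (fun x hx => by
      rw [resolvent_of_not_mem hlf hl η₁ A hx, resolvent_of_not_mem hlf hl η₂ A hx]) x

/-- Both resolvents solve the same equation on the smaller set; outside it one vanishes and the
other is nonnegative. -/
theorem resolvent_mono (hη : ∀ x, 0 ≤ η x) (x : X) :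
    Monotone fun A => resolvent hlf hl η A x := fun A B hAB =>
  resolvent_comparison hlf hl A _ _
    (fun x hx => by
      rw [resolvent_spec hlf hl η A hx, resolvent_spec hlf hl η B (hAB hx)])
    (fun x hx => by
      rw [resolvent_of_not_mem hlf hl η A hx]; exact resolvent_nonneg hlf hl η hη B x) x

open Classical in
/-- Green's formula together with the resolvent equation bounds the energy of the resolvent. -/
theorem sum_gam_resolvent_le (hη : ∀ x, 0 ≤ η x) (hη1 : ∀ x, η x ≤ 1) (S : Finset X)
    (hS : ∀ x, x ∉ S → η x = 0) (A F : Finset X) :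
    ∑ x ∈ F, G.m x * G.Gam (resolvent hlf hl η A) (resolvent hlf hl η A) x
      ≤ 1 / lam * ∑ x ∈ S, G.m x := by
  set f := resolvent hlf hl η A with hf
  have hf0 : ∀ x, 0 ≤ f x := resolvent_nonneg hlf hl η hη A
  have hf1 : ∀ x, f x ≤ 1 / lam := resolvent_le hlf hl η hη1 A
  -- All neighbors of `A ∪ F` lie in `B`, so the energy is dominated by a symmetric double sum over
  -- `B × B`.
  set B : Finset X := (A ∪ F) ∪ (A ∪ F).biUnion (fun x => (hlf x).toFinset)
  have hB : ∀ x ∈ A ∪ F, (hlf x).toFinset ⊆ B := fun x hx =>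
    (Finset.subset_biUnion_of_mem (fun x => (hlf x).toFinset) hx).trans Finset.subset_union_right
  have hAB : A ⊆ B := Finset.subset_union_left.trans Finset.subset_union_left
  have hFB : F ⊆ B := Finset.subset_union_right.trans Finset.subset_union_left
  calc ∑ x ∈ F, G.m x * G.Gam f f x
      = ∑ x ∈ F, 1 / 2 * ∑ y ∈ B, G.b x y * ((f x - f y) * (f x - f y)) := by
        refine Finset.sum_congr rfl fun x hx => ?_
        rw [gam_eq_sum hlf (hB x (Finset.mem_union_right _ hx))]
        have := (G.m_pos x).ne'
        field_simp
    _ ≤ ∑ x ∈ B, 1 / 2 * ∑ y ∈ B, G.b x y * ((f x - f y) * (f x - f y)) :=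
        Finset.sum_le_sum_of_subset_of_nonneg hFB fun x _ _ => mul_nonneg (by norm_num)
          (Finset.sum_nonneg fun y _ => mul_nonneg (G.b_nonneg x y) (mul_self_nonneg _))
    _ = ∑ x ∈ B, f x * ∑ y ∈ B, G.b x y * (f x - f y) := by
        simp only [Finset.mul_sum]
        have hswap : ∑ x ∈ B, ∑ y ∈ B, f x * (G.b x y * (f x - f y))
            = ∑ x ∈ B, ∑ y ∈ B, f y * (G.b x y * (f y - f x)) := by
          rw [Finset.sum_comm]
          refine Finset.sum_congr rfl fun x _ => Finset.sum_congr rfl fun y _ => ?_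
          rw [G.b_symm]
        have hadd : ∑ x ∈ B, ∑ y ∈ B, 1 / 2 * (G.b x y * ((f x - f y) * (f x - f y)))
            = 1 / 2 * (∑ x ∈ B, ∑ y ∈ B, f x * (G.b x y * (f x - f y))
              + ∑ x ∈ B, ∑ y ∈ B, f y * (G.b x y * (f y - f x))) := by
          simp only [← Finset.sum_add_distrib, Finset.mul_sum]
          exact Finset.sum_congr rfl fun x _ => Finset.sum_congr rfl fun y _ => by ring
        rw [hadd, ← hswap]
        ring
    _ = ∑ x ∈ A, f x * ∑ y ∈ B, G.b x y * (f x - f y) := by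
        refine (Finset.sum_subset hAB fun x _ hx => ?_).symm
        rw [hf, resolvent_of_not_mem hlf hl η A hx, zero_mul]
    -- The resolvent equation gives `f · m (η - lam f)`; drop the term `-lam m f²` and use `f ≤
    -- 1/lam`.
    _ ≤ ∑ x ∈ A, 1 / lam * (G.m x * η x) := by
        refine Finset.sum_le_sum fun x hx => ?_
        have h1 := resolvent_spec hlf hl η A hx
        rw [← hf, laplacian_eq_sum hlf (hB x (Finset.mem_union_left _ hx))] at h1
        have hm := G.m_pos x
        have h2 : ∑ y ∈ B, G.b x y * (f x - f y) = G.m x * (η x - lam * f x) := by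
          rw [← h1]
          field_simp
          ring
        rw [h2]
        have h3 : f x * (G.m x * η x) ≤ 1 / lam * (G.m x * η x) :=
          mul_le_mul_of_nonneg_right (hf1 x) (mul_nonneg hm.le (hη x))
        have h4 : 0 ≤ f x * (G.m x * (lam * f x)) :=
          mul_nonneg (hf0 x) (mul_nonneg hm.le (mul_nonneg hl.le (hf0 x)))
        linarith
    _ = 1 / lam * ∑ x ∈ A ∩ S, G.m x * η x := by
        rw [← Finset.mul_sum]
        congr 1
        refine (Finset.sum_subset Finset.inter_subset_left fun x hx hx' => ?_).symm
        rw [hS x fun h => hx' (Finset.mem_inter.2 ⟨hx, h⟩), mul_zero]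
    _ ≤ 1 / lam * ∑ x ∈ S, G.m x := by
        refine mul_le_mul_of_nonneg_left ?_ (by positivity)
        calc _ ≤ ∑ x ∈ A ∩ S, G.m x := Finset.sum_le_sum fun x _ =>
              mul_le_of_le_one_right (G.m_pos x).le (hη1 x)
          _ ≤ _ := Finset.sum_le_sum_of_subset_of_nonneg Finset.inter_subset_right
              fun x _ _ => (G.m_pos x).le

end Resolvent

/-! ### The limiting resolvent and its gradient estimate. -/

theorem tendsto_laplacian (hlf : G.LocallyFinite) {ι : Type*} {l : Filter ι} {f : ι → X → ℝ}
    {u : X → ℝ} (h : ∀ x, Tendsto (fun i => f i x) l (𝓝 (u x))) (x : X) :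
    Tendsto (fun i => G.laplacian (f i) x) l (𝓝 (G.laplacian u x)) := by
  simp only [laplacian_eq_sum hlf subset_rfl]
  exact (tendsto_finsetSum _ fun y _ => ((h x).sub (h y)).const_mul _).const_mul _

theorem tendsto_gam (hlf : G.LocallyFinite) {ι : Type*} {l : Filter ι} {f : ι → X → ℝ}
    {u : X → ℝ} (h : ∀ x, Tendsto (fun i => f i x) l (𝓝 (u x))) (x : X) :
    Tendsto (fun i => G.Gam (f i) (f i) x) l (𝓝 (G.Gam u u x)) := by
  simp only [gam_eq_sum hlf subset_rfl]
  exact (tendsto_finsetSum _ fun y _ =>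
    (((h x).sub (h y)).mul ((h x).sub (h y))).const_mul _).const_mul _

/-- The limit of the Dirichlet resolvents solves the resolvent equation and has finite energy. -/
theorem exists_limit_resolvent (hlf : G.LocallyFinite) {lam : ℝ} (hl : 0 < lam) (η : X → ℝ)
    (hη : ∀ x, 0 ≤ η x) (hη1 : ∀ x, η x ≤ 1) (S : Finset X) (hS : ∀ x, x ∉ S → η x = 0) :
    ∃ u : X → ℝ, (∀ x, Tendsto (fun A => resolvent hlf hl η A x) atTop (𝓝 (u x))) ∧
      (∀ x, lam * u x + G.laplacian u x = η x) ∧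
      ∀ F : Finset X, ∑ x ∈ F, G.m x * G.Gam u u x ≤ 1 / lam * ∑ x ∈ S, G.m x := by
  have hlim : ∀ x, Tendsto (fun A => resolvent hlf hl η A x) atTop
      (𝓝 (⨆ A, resolvent hlf hl η A x)) := fun x =>
    tendsto_atTop_ciSup (resolvent_mono hlf hl η hη x)
      ⟨1 / lam, by rintro _ ⟨A, rfl⟩; exact resolvent_le hlf hl η hη1 A x⟩
  refine ⟨fun x => ⨆ A, resolvent hlf hl η A x, hlim, fun x => ?_, fun F => ?_⟩
  · refine tendsto_nhds_unique (((hlim x).const_mul lam).add (tendsto_laplacian hlf hlim x)) ?_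
    -- The equation at `x` holds exactly as soon as `x ∈ A`.
    refine tendsto_const_nhds.congr' ?_
    filter_upwards [eventually_ge_atTop {x}] with A hA
    exact (resolvent_spec hlf hl η A (hA (Finset.mem_singleton_self x))).symm
  · exact le_of_tendsto (tendsto_finsetSum F fun x _ => (tendsto_gam hlf hlim x).const_mul _)
      (Eventually.of_forall fun A => sum_gam_resolvent_le hlf hl η hη hη1 S hS A F)

/-- Gradient estimate for finite energy solutions of the resolvent equation. -/
theorem gam_le_of_resolvent_equation (hlf : G.LocallyFinite) (hm : 0 < ⨅ x, G.m x) {K lam : ℝ}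
    (hK : 0 < K + lam) (hCD : G.CD K) {u η : X → ℝ}
    (hu : ∀ x, lam * u x + G.laplacian u x = η x) {C δ : ℝ}
    (hC : ∀ F : Finset X, ∑ x ∈ F, G.m x * G.Gam u u x ≤ C)
    (hδ : ∀ x, G.Gam η η x ≤ δ) (x : X) : (K + lam) ^ 2 * G.Gam u u x ≤ δ := by
  have hδ0 : 0 ≤ δ := (gam_self_nonneg hlf η x).trans (hδ x)
  by_contra! hx
  have hpos : 0 < G.Gam u u x := by
    by_contra! h
    nlinarith [sq_nonneg (K + lam)]
  have hmle : ∀ z, (⨅ x, G.m x) ≤ G.m z := fun z =>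
    ciInf_le ⟨0, by rintro _ ⟨y, rfl⟩; exact (G.m_pos y).le⟩ z
  -- Chebyshev: `n` points of this superlevel set carry energy at least `n (inf m) Γ(u)(x)`, which
  -- exceeds `C` for large `n`.
  have hfin : {z | G.Gam u u x ≤ G.Gam u u z}.Finite := by
    by_contra hinf
    obtain ⟨n, hn⟩ := exists_nat_gt (C / ((⨅ x, G.m x) * G.Gam u u x))
    obtain ⟨F, hF, hcard⟩ := (Set.not_finite.1 hinf : Set.Infinite _).exists_subset_card_eq n
    have h1 : ∑ z ∈ F, (⨅ x, G.m x) * G.Gam u u x ≤ ∑ z ∈ F, G.m z * G.Gam u u z :=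
      Finset.sum_le_sum fun z hz =>
        mul_le_mul (hmle z) (hF hz) hpos.le (G.m_pos z).le
    rw [Finset.sum_const, hcard, nsmul_eq_mul] at h1
    rw [div_lt_iff₀ (mul_pos hm hpos)] at hn
    linarith [hC F]
  obtain ⟨z, hz, hmax⟩ := hfin.toFinset.exists_max_image (G.Gam u u) ⟨x, by simp⟩
  have hxz : G.Gam u u x ≤ G.Gam u u z := by simpa using hz
  have hglob : ∀ y, G.Gam u u y ≤ G.Gam u u z := fun y => by
    rcases le_total (G.Gam u u x) (G.Gam u u y) with h | h
    · exact hmax y (by simpa using h)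
    · exact h.trans hxz
  have h1 := laplacian_nonneg_of_forall_le (G := G) (G.Gam u u) z hglob
  have h2 := hCD u z
  have h3 : G.Gam u (G.laplacian u) z = G.Gam u η z - lam * G.Gam u u z := by
    simp only [gam_eq_sum hlf subset_rfl, Finset.mul_sum, ← Finset.sum_sub_distrib]
    refine Finset.sum_congr rfl fun y _ => ?_
    rw [← hu z, ← hu y]
    ring
  rw [Gam₂, h3] at h2
  -- At the maximum `-½ 𝓛 Γ(u) ≤ 0`, so the curvature condition leaves `K Γ(u) ≤ Γ(u, η) - lam
  -- Γ(u)`.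
  have h4 : (K + lam) * G.Gam u u z ≤ G.Gam u η z := by linarith
  have h5 := gam_sq_le hlf u η z
  have hzpos := hpos.trans_le hxz
  have h6 : ((K + lam) * G.Gam u u z) ^ 2 ≤ G.Gam u u z * δ :=
    (pow_le_pow_left₀ (mul_pos hK hzpos).le h4 2).trans
      (h5.trans (mul_le_mul_of_nonneg_left (hδ z) hzpos.le))
  have h7 : (K + lam) ^ 2 * G.Gam u u z ≤ δ := by
    refine le_of_mul_le_mul_left ?_ hzpos
    calc _ = ((K + lam) * G.Gam u u z) ^ 2 := by ring
      _ ≤ _ := h6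
  have h8 := mul_le_mul_of_nonneg_left hxz (sq_nonneg (K + lam))
  linarith

/-! ### Cutoff functions and the resolvent of the constant `1`. -/

section Cutoff

variable [PseudoMetricSpace X]

/-- The cutoff function `(1 - ϱ(o, ·) / R)₊`. -/
noncomputable def cutoff (o : X) (R : ℝ) (x : X) : ℝ := max 0 (1 - dist x o / R)

theorem cutoff_sub_sq_le (o : X) {R : ℝ} (hR : 0 < R) (x y : X) :
    (cutoff o R x - cutoff o R y) * (cutoff o R x - cutoff o R y) ≤ 1 / R ^ 2 * dist x y ^ 2 := by
  have h1 : |cutoff o R x - cutoff o R y| ≤ dist x y / R := by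
    have h2 : |cutoff o R x - cutoff o R y| ≤ |(1 - dist x o / R) - (1 - dist y o / R)| := by
      rw [cutoff, cutoff, max_comm 0, max_comm 0]
      exact abs_max_sub_max_le_abs _ _ _
    refine h2.trans ?_
    rw [show (1 - dist x o / R) - (1 - dist y o / R) = -((dist x o - dist y o) / R) by ring,
      abs_neg, abs_div, abs_of_pos hR]
    exact div_le_div_of_nonneg_right (abs_dist_sub_le x y o) hR.le
  calc _ = |cutoff o R x - cutoff o R y| ^ 2 := by rw [sq_abs]; ring
    _ ≤ (dist x y / R) ^ 2 := pow_le_pow_left₀ (abs_nonneg _) h1 2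
    _ = _ := by ring

/-- The cutoff is `1/R`-Lipschitz, so the intrinsic property gives even `1/(2 R²)`; the factor `1/2`
is not needed. -/
theorem gam_cutoff_le (hlf : G.LocallyFinite) (hintr : G.IsIntrinsic) (o : X) {R : ℝ}
    (hR : 0 < R) (x : X) : G.Gam (cutoff o R) (cutoff o R) x ≤ 1 / R ^ 2 := by
  rw [gam_eq_sum hlf subset_rfl]
  have hm := G.m_pos x
  have h := (hintr x).2
  rw [tsum_b_mul_of_subset hlf subset_rfl fun y => dist x y ^ 2] at h
  have h1 : ∑ y ∈ (hlf x).toFinset, G.b x y *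
      ((cutoff o R x - cutoff o R y) * (cutoff o R x - cutoff o R y)) ≤ 1 / R ^ 2 * G.m x := by
    calc _ ≤ ∑ y ∈ (hlf x).toFinset, 1 / R ^ 2 * (G.b x y * dist x y ^ 2) :=
          Finset.sum_le_sum fun y _ => by
            have := mul_le_mul_of_nonneg_left (cutoff_sub_sq_le o hR x y) (G.b_nonneg x y)
            linarith
      _ ≤ _ := by
          rw [← Finset.mul_sum]
          exact mul_le_mul_of_nonneg_left h (by positivity)
  calc _ ≤ 1 / (2 * G.m x) * (1 / R ^ 2 * G.m x) :=
        mul_le_mul_of_nonneg_left h1 (by positivity)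
    _ = 1 / 2 * (1 / R ^ 2) := by field_simp
    _ ≤ 1 / R ^ 2 := by
        have : 0 ≤ 1 / R ^ 2 := by positivity
        linarith

/-- Under the curvature condition, `lam (lam + L)⁻¹ 1 = 1` for the minimal resolvent. -/
theorem tendsto_resolvent_one (hlf : G.LocallyFinite) (hm : 0 < ⨅ x, G.m x)
    (hintr : G.IsIntrinsic) (hballs : ∀ (x : X) (r : ℝ), (Metric.closedBall x r).Finite)
    {K lam : ℝ} (hl : 0 < lam) (hK : 0 < K + lam) (hCD : G.CD K) (o : X) :
    Tendsto (fun A => lam * resolvent hlf hl (fun _ => 1) A o) atTop (𝓝 1) := by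
  -- Independent of `R`: the root is the constant of `laplacian_sq_le` at `o`, the denominator that
  -- of the gradient estimate.
  set D : ℝ := √(2 / G.m o * ∑ y ∈ (hlf o).toFinset, G.b o y) / (K + lam) with hD
  have hDeg : 0 ≤ 2 / G.m o * ∑ y ∈ (hlf o).toFinset, G.b o y :=
    mul_nonneg (div_pos two_pos (G.m_pos o)).le (Finset.sum_nonneg fun y _ => G.b_nonneg o y)
  have hcut0 : ∀ R x, 0 ≤ cutoff o R x := fun R x => le_max_left _ _
  have hcut1 : ∀ R, 0 < R → ∀ x, cutoff o R x ≤ 1 := fun R hR x =>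
    max_le zero_le_one (by have : 0 ≤ dist x o / R := by positivity
                           linarith)
  -- As the cutoff equals `1` at `o`, the equation reads `lam u(o) = 1 - 𝓛 u(o)`, and `𝓛 u(o) ≤ D /
  -- R`.
  have key : ∀ R : ℝ, 0 < R → ∃ u : ℝ,
      Tendsto (fun A => resolvent hlf hl (cutoff o R) A o) atTop (𝓝 u) ∧
        1 - D / R ≤ lam * u := by
    intro R hR
    obtain ⟨u, hlim, heq, hen⟩ := exists_limit_resolvent hlf hl (cutoff o R) (hcut0 R)
      (hcut1 R hR) (hballs o R).toFinset (fun x hx => by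
        simp only [Set.Finite.mem_toFinset, Metric.mem_closedBall, not_le] at hx
        refine max_eq_left ?_
        rw [sub_nonpos, le_div_iff₀ hR]
        linarith)
    refine ⟨u o, hlim o, ?_⟩
    have hgam := gam_le_of_resolvent_equation hlf hm hK hCD heq hen
      (gam_cutoff_le hlf hintr o hR) o
    have hL := laplacian_sq_le hlf u o
    have hL2 : G.laplacian u o ^ 2 ≤ (D / R) ^ 2 := by
      refine hL.trans ?_
      have hgam' : G.Gam u u o ≤ 1 / ((K + lam) ^ 2 * R ^ 2) := by
        rw [le_div_iff₀ (by positivity)]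
        rw [le_div_iff₀ (by positivity)] at hgam
        linarith
      rw [hD, div_pow, div_pow, Real.sq_sqrt hDeg, div_div]
      refine (mul_le_mul_of_nonneg_left hgam' hDeg).trans_eq ?_
      rw [mul_one_div]
    have hLle : G.laplacian u o ≤ D / R := le_of_sq_le_sq hL2 (by positivity)
    have h1 : cutoff o R o = 1 := by simp [cutoff]
    have := heq o
    linarith
  refine tendsto_order.2 ⟨fun a ha => ?_, fun a ha => ?_⟩
  · have hlimD : Tendsto (fun R : ℝ => 1 - D / R) atTop (𝓝 1) := by
      simpa using (tendsto_const_nhds (x := (1 : ℝ))).sub (tendsto_id.const_div_atTop D)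
    obtain ⟨R, hRa, hR⟩ :=
      ((hlimD.eventually (lt_mem_nhds ha)).and (eventually_gt_atTop 0)).exists
    obtain ⟨u, hu, hle⟩ := key R hR
    filter_upwards [(hu.const_mul lam).eventually (lt_mem_nhds (hRa.trans_le hle))] with A hA
    -- The cutoff lies below `1`, so its resolvent lies below that of `1`.
    exact hA.trans_le (mul_le_mul_of_nonneg_left
      (resolvent_mono_right hlf hl (hcut1 R hR) A o) hl.le)
  · refine Eventually.of_forall fun A => lt_of_le_of_lt ?_ ha
    have := resolvent_le hlf hl (fun _ => 1) (fun _ => le_rfl) A o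
    rw [le_div_iff₀ hl] at this
    linarith

end Cutoff

end WeightedGraph

/-! ### Restricted heat kernels and their limit. -/

namespace WeightedGraph

open NormedSpace
open scoped Classical

variable {X : Type*} {G : WeightedGraph X}

theorem restrictedLaplacian_nonpos (hlf : G.LocallyFinite) (A : Finset X) (i j : A)
    (hij : i ≠ j) : G.restrictedLaplacian A i j ≤ 0 := by
  refine laplacian_nonpos_of_forall_le hlf _ _ fun z => ?_
  have hne : (i : X) ≠ j := fun h => hij (Subtype.ext h)
  rw [Pi.single_eq_of_ne hne]
  by_cases h : z = j
  · subst h; simp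
  · rw [Pi.single_eq_of_ne h]

theorem sum_restrictedLaplacian_mul (hlf : G.LocallyFinite) (A : Finset X) (f : A → ℝ) (i : A) :
    ∑ j, G.restrictedLaplacian A i j * f j = G.laplacian (extendZero A f) i := by
  have hext : ∀ z, extendZero A f z = ∑ j : A, Pi.single (M := fun _ : X => ℝ) (j : X) 1 z * f j := by
    intro z
    by_cases hz : z ∈ A
    · rw [Finset.sum_eq_single (⟨z, hz⟩ : A)]
      · simp [extendZero, hz]
      · intro j _ hj
        have hne : z ≠ (j : X) := fun h => hj (Subtype.ext h.symm)
        rw [Pi.single_eq_of_ne hne, zero_mul]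
      · simp
    · rw [extendZero_of_not_mem A f hz]
      refine (Finset.sum_eq_zero fun j _ => ?_).symm
      have hne : z ≠ (j : X) := fun h => hz (h ▸ j.2)
      rw [Pi.single_eq_of_ne hne, zero_mul]
  simp only [restrictedLaplacian, Matrix.of_apply, laplacian_eq_sum hlf subset_rfl, hext,
    ← Finset.sum_sub_distrib, Finset.mul_sum, Finset.sum_mul]
  rw [Finset.sum_comm]
  exact Finset.sum_congr rfl fun y _ => Finset.sum_congr rfl fun j _ => by ring

/-- The row sum is `𝓛 1_A`, and `1_A` attains its maximum at every point of `A`. The excess is the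
killing at the boundary. -/
theorem sum_restrictedLaplacian_nonneg (hlf : G.LocallyFinite) (A : Finset X) (i : A) :
    0 ≤ ∑ j, G.restrictedLaplacian A i j := by
  have h := sum_restrictedLaplacian_mul hlf A (fun _ => 1) i
  simp only [mul_one] at h
  rw [h]
  refine laplacian_nonneg_of_forall_le _ _ fun y => ?_
  rw [extendZero_coe]
  by_cases hy : y ∈ A <;> simp [extendZero, hy]

theorem restrictedHeatKernel_mul_m (A : Finset X) (t : ℝ) {x y : X} (hx : x ∈ A) (hy : y ∈ A) :
    G.restrictedHeatKernel A t x y * G.m y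
      = exp (-t • G.restrictedLaplacian A) ⟨x, hx⟩ ⟨y, hy⟩ := by
  rw [restrictedHeatKernel, dif_pos ⟨hx, hy⟩, Matrix.mulVec_single]
  have := (G.m_pos y).ne'
  simp [this]

theorem restrictedHeatKernel_of_not_mem (A : Finset X) (t : ℝ) {x y : X}
    (h : ¬(x ∈ A ∧ y ∈ A)) : G.restrictedHeatKernel A t x y = 0 := by
  rw [restrictedHeatKernel, dif_neg h]

theorem restrictedHeatKernel_nonneg (hlf : G.LocallyFinite) (A : Finset X) {t : ℝ} (ht : 0 ≤ t)
    (x y : X) : 0 ≤ G.restrictedHeatKernel A t x y := by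
  by_cases h : x ∈ A ∧ y ∈ A
  · refine nonneg_of_mul_nonneg_left ?_ (G.m_pos y)
    rw [restrictedHeatKernel_mul_m A t h.1 h.2]
    exact Matrix.exp_neg_smul_apply_nonneg _ (restrictedLaplacian_nonpos hlf A) ht _ _
  · rw [restrictedHeatKernel_of_not_mem A t h]

theorem sum_restrictedHeatKernel_eq (A : Finset X) (t : ℝ) {x : X} (hx : x ∈ A) :
    ∑ y ∈ A, G.restrictedHeatKernel A t x y * G.m y
      = ∑ j, exp (-t • G.restrictedLaplacian A) ⟨x, hx⟩ j := by
  rw [← Finset.sum_coe_sort A]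
  exact Finset.sum_congr rfl fun j _ => restrictedHeatKernel_mul_m A t hx j.2

theorem hasDerivAt_sum_exp (A : Finset X) (s : ℝ) (i : A) :
    HasDerivAt (fun r : ℝ => ∑ j, exp (-r • G.restrictedLaplacian A) i j)
      (-∑ k, G.restrictedLaplacian A i k * ∑ j, exp (-s • G.restrictedLaplacian A) k j) s := by
  refine (HasDerivAt.fun_sum (u := Finset.univ) fun j _ =>
    Matrix.hasDerivAt_exp_neg_smul_apply_eq_sum (G.restrictedLaplacian A) s i j).congr_deriv ?_
  rw [Finset.sum_neg_distrib]
  congr 1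
  simp only [Finset.mul_sum]
  exact Finset.sum_comm

/-- The constant `1` is a supersolution of the Dirichlet heat equation. -/
theorem sum_restrictedHeatKernel_le_one (hlf : G.LocallyFinite) (A : Finset X) {t : ℝ}
    (ht : 0 ≤ t) (x : X) : ∑ y ∈ A, G.restrictedHeatKernel A t x y * G.m y ≤ 1 := by
  by_cases hx : x ∈ A
  · rw [sum_restrictedHeatKernel_eq A t hx]
    have := Matrix.nonneg_of_supersolution (G.restrictedLaplacian A)
      (restrictedLaplacian_nonpos hlf A)
      (fun s i => 1 - ∑ j, exp (-s • G.restrictedLaplacian A) i j) _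
      (fun s i => (hasDerivAt_sum_exp A s i).const_sub 1)
      (fun i => by simp [Matrix.one_apply])
      (fun s _ i => by
        simp only [mul_sub, mul_one, Finset.sum_sub_distrib]
        have := sum_restrictedLaplacian_nonneg hlf A i
        linarith) ht ⟨x, hx⟩
    linarith
  · rw [Finset.sum_eq_zero fun y _ => by
      rw [restrictedHeatKernel_of_not_mem A t fun h => hx h.1, zero_mul]]
    exact zero_le_one

/-- The mass of the restricted heat semigroup is bounded below by means of the resolvent. -/
theorem le_sum_restrictedHeatKernel (hlf : G.LocallyFinite) {lam : ℝ} (hl : 0 < lam)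
    (A : Finset X) {t : ℝ} (ht : 0 ≤ t) {x : X} (hx : x ∈ A) :
    1 - Real.exp (lam * t) * (1 - lam * resolvent hlf hl (fun _ => 1) A x)
      ≤ ∑ y ∈ A, G.restrictedHeatKernel A t x y * G.m y := by
  rw [sum_restrictedHeatKernel_eq A t hx]
  set u := resolvent hlf hl (fun _ => 1) A with hu
  have hext : extendZero A (fun j : A => u j) = u := by
    funext z
    by_cases hz : z ∈ A
    · simp [extendZero, hz]
    · rw [extendZero_of_not_mem A _ hz, hu, resolvent_of_not_mem hlf hl _ A hz]
  have hMu : ∀ i : A, ∑ j, G.restrictedLaplacian A i j * u j = 1 - lam * u i := by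
    intro i
    rw [sum_restrictedLaplacian_mul hlf A (fun j : A => u j) i, hext]
    have := resolvent_spec hlf hl (fun _ => 1) A i.2
    rw [← hu] at this
    linarith
  have hexp : ∀ s, HasDerivAt (fun r : ℝ => Real.exp (lam * r)) (lam * Real.exp (lam * s)) s := by
    intro s
    have := ((hasDerivAt_id s).const_mul lam).exp
    simpa [mul_comm] using this
  -- With `M = L_A` and `w = 1 - lam u`, one has `lam w + M w = M 1`. Hence `exp(lam s) w - 1`
  -- satisfies `φ' + M φ = (exp(lam s) - 1) M 1 ≥ 0`. Adding the mass, which solves the homogeneous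
  -- equation, gives the initial value `w ≥ 0`.
  have := Matrix.nonneg_of_supersolution (G.restrictedLaplacian A)
    (restrictedLaplacian_nonpos hlf A)
    (fun s i => ∑ j, exp (-s • G.restrictedLaplacian A) i j
      + (Real.exp (lam * s) * (1 - lam * u i) - 1)) _
    (fun s i => (hasDerivAt_sum_exp A s i).add
      (((hexp s).mul_const (1 - lam * u i)).sub_const 1))
    (fun i => by
      have h1 := resolvent_le hlf hl (fun _ => 1) (fun _ => le_rfl) A i
      rw [le_div_iff₀ hl, ← hu] at h1
      simp [Matrix.one_apply]
      linarith)
    (fun s hs i => by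
      have h1 := sum_restrictedLaplacian_nonneg hlf A i
      have h2 : ∑ j, G.restrictedLaplacian A i j * (∑ k, exp (-s • G.restrictedLaplacian A) j k
          + (Real.exp (lam * s) * (1 - lam * u j) - 1))
          = ∑ j, G.restrictedLaplacian A i j * ∑ k, exp (-s • G.restrictedLaplacian A) j k
            + (Real.exp (lam * s) - 1) * ∑ j, G.restrictedLaplacian A i j
            - Real.exp (lam * s) * lam * ∑ j, G.restrictedLaplacian A i j * u j := by
        rw [Finset.mul_sum, Finset.mul_sum, ← Finset.sum_add_distrib, ← Finset.sum_sub_distrib]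
        exact Finset.sum_congr rfl fun j _ => by ring
      rw [h2, hMu]
      have h3 : 0 ≤ (Real.exp (lam * s) - 1) * ∑ j, G.restrictedLaplacian A i j :=
        mul_nonneg (sub_nonneg.2 (Real.one_le_exp (mul_nonneg hl.le hs))) h1
      linarith) ht ⟨x, hx⟩
  linarith

/-- On `A` the kernel of `B` is a supersolution for `L_A` with the same initial value: the terms of
`L_B` from `B \ A` are nonpositive. -/
theorem restrictedHeatKernel_mono (hlf : G.LocallyFinite) {t : ℝ} (ht : 0 ≤ t) (x y : X) :
    Monotone fun A => G.restrictedHeatKernel A t x y := by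
  intro A B hAB
  by_cases h : x ∈ A ∧ y ∈ A
  · obtain ⟨hx, hy⟩ := h
    refine le_of_mul_le_mul_right ?_ (G.m_pos y)
    rw [restrictedHeatKernel_mul_m A t hx hy, restrictedHeatKernel_mul_m B t (hAB hx) (hAB hy)]
    let e : A → B := fun i => ⟨i, hAB i.2⟩
    have he : Function.Injective e := fun i j hij => Subtype.ext (congrArg (fun z : B => (z : X)) hij)
    have := Matrix.nonneg_of_supersolution (G.restrictedLaplacian A)
      (restrictedLaplacian_nonpos hlf A)
      (fun s i => exp (-s • G.restrictedLaplacian B) (e i) (e ⟨y, hy⟩)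
        - exp (-s • G.restrictedLaplacian A) i ⟨y, hy⟩) _
      (fun s i => (Matrix.hasDerivAt_exp_neg_smul_apply_eq_sum _ s _ _).sub
        (Matrix.hasDerivAt_exp_neg_smul_apply_eq_sum _ s _ _))
      (fun i => by simp [Matrix.one_apply, he.eq_iff])
      (fun s hs i => by
        simp only [mul_sub, Finset.sum_sub_distrib]
        have h1 : ∑ k, G.restrictedLaplacian B (e i) k
              * exp (-s • G.restrictedLaplacian B) k (e ⟨y, hy⟩)
            ≤ ∑ k ∈ Finset.univ.image e, G.restrictedLaplacian B (e i) k
              * exp (-s • G.restrictedLaplacian B) k (e ⟨y, hy⟩) := by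
          rw [← Finset.sum_sdiff (Finset.subset_univ (Finset.univ.image e))]
          refine add_le_of_nonpos_left (Finset.sum_nonpos fun k hk => ?_)
          refine mul_nonpos_of_nonpos_of_nonneg (restrictedLaplacian_nonpos hlf B _ _ ?_)
            (Matrix.exp_neg_smul_apply_nonneg _ (restrictedLaplacian_nonpos hlf B) hs _ _)
          rintro rfl
          simp at hk
        rw [Finset.sum_image fun i _ j _ hij => he hij] at h1
        -- An entry of the restricted Laplacian depends only on the two vertices, not on the finite
        -- set.
        have h2 : ∀ k, G.restrictedLaplacian B (e i) (e k) = G.restrictedLaplacian A i k :=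
          fun k => rfl
        simp only [h2] at h1
        linarith) ht ⟨x, hx⟩
    exact sub_nonneg.1 this
  · simp only [restrictedHeatKernel_of_not_mem A t h]
    exact restrictedHeatKernel_nonneg hlf B ht x y

theorem sum_restrictedHeatKernel_le_one' (hlf : G.LocallyFinite) (A F : Finset X) {t : ℝ}
    (ht : 0 ≤ t) (x : X) : ∑ y ∈ F, G.restrictedHeatKernel A t x y * G.m y ≤ 1 := by
  refine le_trans ?_ (sum_restrictedHeatKernel_le_one hlf A ht x)
  have hnn : ∀ y, 0 ≤ G.restrictedHeatKernel A t x y * G.m y := fun y =>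
    mul_nonneg (restrictedHeatKernel_nonneg hlf A ht x y) (G.m_pos y).le
  rw [← Finset.sum_subset (Finset.inter_subset_left : F ∩ A ⊆ F) fun y hy hy' => by
    rw [restrictedHeatKernel_of_not_mem A t fun h => hy' (Finset.mem_inter.2 ⟨hy, h.2⟩), zero_mul]]
  exact Finset.sum_le_sum_of_subset_of_nonneg Finset.inter_subset_right fun y _ _ => hnn y

/-- If `lam (lam + L)⁻¹ 1 = 1` for the minimal resolvent, then the graph is stochastically
complete. -/
theorem stochasticallyComplete_of_tendsto_resolvent (hlf : G.LocallyFinite) {lam : ℝ}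
    (hl : 0 < lam)
    (hres : ∀ x, Tendsto (fun A => lam * resolvent hlf hl (fun _ => 1) A x) atTop (𝓝 1)) :
    G.StochasticallyComplete := by
  have hbdd : ∀ t, 0 ≤ t → ∀ x y,
      BddAbove (Set.range fun A => G.restrictedHeatKernel A t x y) := by
    rintro t ht x y
    refine ⟨1 / G.m y, ?_⟩
    rintro _ ⟨A, rfl⟩
    rw [le_div_iff₀ (G.m_pos y)]
    simpa using sum_restrictedHeatKernel_le_one' hlf A {y} ht x
  have hlim : G.IsHeatKernel fun t x y => ⨆ A, G.restrictedHeatKernel A t x y :=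
    fun t ht x y => tendsto_atTop_ciSup (restrictedHeatKernel_mono hlf ht x y) (hbdd t ht x y)
  refine ⟨_, hlim, fun t ht x => ?_⟩
  set p : X → ℝ := fun y => ⨆ A, G.restrictedHeatKernel A t x y
  have hle : ∀ A y, G.restrictedHeatKernel A t x y ≤ p y := fun A y => le_ciSup (hbdd t ht x y) A
  have hp : ∀ y, 0 ≤ p y * G.m y := fun y =>
    mul_nonneg ((restrictedHeatKernel_nonneg hlf ∅ ht x y).trans (hle ∅ y)) (G.m_pos y).le
  have hsum : ∀ F : Finset X, ∑ y ∈ F, p y * G.m y ≤ 1 := fun F =>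
    le_of_tendsto (tendsto_finsetSum F fun y _ => (hlim t ht x y).mul_const (G.m y))
      (Eventually.of_forall fun A => sum_restrictedHeatKernel_le_one' hlf A F ht x)
  have hsummable : Summable fun y => p y * G.m y := summable_of_sum_le hp hsum
  have hge : 1 ≤ ∑' y, p y * G.m y := by
    -- The mass on `A` of the limit kernel dominates that of the restricted one, whose lower bound
    -- tends to `1`.
    have h1 : Tendsto (fun A => 1 - Real.exp (lam * t) *
        (1 - lam * resolvent hlf hl (fun _ => 1) A x)) atTop (𝓝 1) := by
      simpa using (tendsto_const_nhds (x := (1 : ℝ))).sub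
        (((tendsto_const_nhds (x := (1 : ℝ))).sub (hres x)).const_mul (Real.exp (lam * t)))
    refine le_of_tendsto h1 ?_
    filter_upwards [eventually_ge_atTop {x}] with A hA
    calc _ ≤ ∑ y ∈ A, G.restrictedHeatKernel A t x y * G.m y :=
          le_sum_restrictedHeatKernel hlf hl A ht (hA (Finset.mem_singleton_self x))
      _ ≤ ∑ y ∈ A, p y * G.m y := Finset.sum_le_sum fun y _ =>
          mul_le_mul_of_nonneg_right (hle A y) (G.m_pos y).le
      _ ≤ _ := hsummable.sum_le_tsum A fun y _ => hp y
  have heq : ∑' y, p y * G.m y = 1 :=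
    le_antisymm (hsummable.tsum_le_of_sum_le hsum) hge
  exact heq ▸ hsummable.hasSum

end WeightedGraph

theorem theoremt {X : Type*} [Countable X] [Infinite X] [PseudoMetricSpace X]
    (G : WeightedGraph X) (hlf : G.LocallyFinite) (hconn : G.Connected)
    (hm : 0 < ⨅ x, G.m x) (hintr : G.IsIntrinsic)
    (hballs : ∀ (x : X) (r : ℝ), (Metric.closedBall x r).Finite)
    (K : ℝ) (hCD : G.CD K) : G.StochasticallyComplete := by
  -- One admissible `lam` suffices; `|K| + 1` makes `K + lam ≥ 1`.
  have hl : 0 < |K| + 1 := by positivity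
  have hK : 0 < K + (|K| + 1) := by linarith [neg_abs_le K]
  exact WeightedGraph.stochasticallyComplete_of_tendsto_resolvent hlf hl fun o =>
    WeightedGraph.tendsto_resolvent_one hlf hm hintr hballs hl hK hCD o
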